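/- Let $m\ge 1$ be fixed. For each $n>m$ let $h_i$, $-m+2\le i\le n$, be i.i.d. $N(0,1)$ random variables and let $H$ be the $n\times m$ Toeplitz matrix $$H=\begin{bmatrix} h_{-m+2} & h_{-m+3} & \cdots & h_1\\ h_{-m+3} & h_{-m+4} & \cdots & h_2\\ \vdots & & & \vdots\\ h_{-m+n+1} & \cdots & \cdots & h_n\end{bmatrix},\qquad H_{ij}=h_{i+j-m}\quad(1\le i\le n,\ 1\le j\le m).$$ Let $y=Hx+e+w$, where $x\in\mathbb R^m$ is an arbitrary (possibly random, possibly $n$-dependent) state, $e\in\mathbb R^n$ is an outlier vector with almost surely at most $\beta n$ nonzero entries for a constant $\beta<1$, $w\in\mathbb R^n$ is an observation noise vector, and $e,w$ are deterministic or random with $e+w$ independent of $(h_i)_{-m+2\le i\le n}$. No independence or common distribution of the entries of $e$ or $w$ is assumed. An event depending on $n$ holds *with high probability* if its probability tends to $1$ as $n\to\infty$. Suppose that for every $t>0$ there is a constant $\alpha(t)>0$, not depending on $n$, such that with high probability at least $\alpha(t)\,n$ entries of $e+w$ have magnitude at most $t$. Then the problem $\min_{z\in\mathbb R^m}\|y-Hz\|_1$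 always has a solution, and its solutions converge to $x$ in probability: for every $\varepsilon>0$, with high probability every solution $\hat x$ satisfies $\|\hat x-x\|_2<\varepsilon$. -/

import Mathlib

open MeasureTheory ProbabilityTheory Filter Topology

/-- The `n × m` Toeplitz matrix of the problem: its first row is `h_{-m+2}, …, h_1`, its last row is
`h_{-m+n+1}, …, h_n`, and each row is the previous one with all indices increased by one.
Only `h_i` with `-m+2 ≤ i ≤ n` occur. Rows and columns are numbered from `0` here. -/
def toeplitzMatrix (m n : ℕ) (h : ℤ → ℝ) : Matrix (Fin n) (Fin m) ℝ :=
  Matrix.of fun i j => h (2 - (m : ℤ) + (i : ℕ) + (j : ℕ))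

/-- The observation `y = H x + e + w`. -/
def observation {m n : ℕ} (H : Matrix (Fin n) (Fin m) ℝ) (x : EuclideanSpace ℝ (Fin m))
    (e w : Fin n → ℝ) : Fin n → ℝ :=
  H.mulVec x.ofLp + e + w

/-- `xhat` is a solution of the minimization problem `min_z ‖y - H z‖₁`. -/
def IsL1Estimate {m n : ℕ} (H : Matrix (Fin n) (Fin m) ℝ) (y : Fin n → ℝ)
    (xhat : EuclideanSpace ℝ (Fin m)) : Prop :=
  ∀ z : EuclideanSpace ℝ (Fin m),
    ∑ i, |y i - H.mulVec xhat.ofLp i| ≤ ∑ i, |y i - H.mulVec z.ofLp i|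

/-- The number of nonzero entries of a vector. -/
noncomputable def numNonzero {n : ℕ} (v : Fin n → ℝ) : ℕ := {i : Fin n | v i ≠ 0}.ncard

/-- The number of entries of a vector of magnitude at most `t`. -/
noncomputable def numSmall {n : ℕ} (t : ℝ) (v : Fin n → ℝ) : ℕ := {i : Fin n | |v i| ≤ t}.ncard

/-- The events `E n` hold with high probability as `n → ∞`: the probability of the complement of
`E n` tends to `0` (for a set that is not measurable this is the outer measure of the complement,
so that `E n` contains measurable events whose probabilities tend to `1`). -/
def WithHighProbability {Ω : ℕ → Type*} [∀ n, MeasurableSpace (Ω n)]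
    (P : ∀ n, Measure (Ω n)) (E : ∀ n, Set (Ω n)) : Prop :=
  Tendsto (fun n => P n (E n)ᶜ) atTop (𝓝 0)

/-!
Moving the state by `d` changes the `ℓ¹` objective by the excess `∑ i, (|v i - ⟪a i, d⟫| - |v i|)`,
where `a i` are the rows of `H` and `v = e + w`. The excess is convex in `d` and vanishes at `0`,
so every solution lies within `ε` of the state as soon as the excess is positive on the sphere of
radius `ε`.

For fixed `v` and `d`, each term has nonnegative mean by Jensen's inequality, since the inputs are
centered, and mean at least `E |⟪a, d⟫| - 2 t` when `|v i| ≤ t`. Hence the mean excess grows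
linearly in `n`. Rows whose indices differ by at least `m` are independent, so the variance of the
excess is `O(n)` and Chebyshev's inequality applies; independence of `v` and the inputs allows
conditioning on `v`. A finite net of the sphere suffices, because the excess is Lipschitz in `d`
with constant `∑ i, ‖a i‖`, which is `O(n)` with high probability.
-/

section L1Excess

open scoped InnerProductSpace

variable {ι E : Type*} [Fintype ι] [NormedAddCommGroup E] [InnerProductSpace ℝ E]

/-- The increase `∑ i, |v i - ⟪a i, d⟫| - ∑ i, |v i|` of the `ℓ¹` objective with regressors `a` and
disturbance `v` when the true state is moved by `d`. -/
noncomputable def l1Excess (a : ι → E) (v : ι → ℝ) (d : E) : ℝ :=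
  ∑ i, (|v i - ⟪a i, d⟫_ℝ| - |v i|)

theorem l1Excess_smul_le (a : ι → E) (v : ι → ℝ) (d : E) {s : ℝ} (hs0 : 0 ≤ s) (hs1 : s ≤ 1) :
    l1Excess a v (s • d) ≤ s * l1Excess a v d := by
  rw [l1Excess, l1Excess, Finset.mul_sum]
  refine Finset.sum_le_sum fun i _ => ?_
  have h := abs_add_le (s * (v i - ⟪a i, d⟫_ℝ)) ((1 - s) * v i)
  rw [abs_mul, abs_mul, abs_of_nonneg hs0, abs_of_nonneg (sub_nonneg.2 hs1)] at h
  rw [real_inner_smul_right,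
    show v i - s * ⟪a i, d⟫_ℝ = s * (v i - ⟪a i, d⟫_ℝ) + (1 - s) * v i by ring]
  linarith

theorem l1Excess_le_add (a : ι → E) (v : ι → ℝ) (d d' : E) :
    l1Excess a v d ≤ l1Excess a v d' + dist d d' * ∑ i, ‖a i‖ := by
  rw [l1Excess, l1Excess, Finset.mul_sum, ← Finset.sum_add_distrib]
  refine Finset.sum_le_sum fun i _ => ?_
  have hinner : |⟪a i, d' - d⟫_ℝ| ≤ dist d d' * ‖a i‖ := by
    rw [dist_comm, dist_eq_norm, mul_comm]
    exact abs_real_inner_le_norm _ _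
  have htri := abs_sub_abs_le_abs_sub (v i - ⟪a i, d⟫_ℝ) (v i - ⟪a i, d'⟫_ℝ)
  rw [sub_sub_sub_cancel_left, ← inner_sub_right] at htri
  linarith

theorem l1Excess_pos_of_subset_iUnion_ball {a : ι → E} {v : ι → ℝ} {s N : Set E} {r η : ℝ}
    (hs : s ⊆ ⋃ d ∈ N, Metric.ball d r) (hN : ∀ d ∈ N, η < l1Excess a v d)
    (hr : r * ∑ i, ‖a i‖ ≤ η) {d : E} (hd : d ∈ s) : 0 < l1Excess a v d := by
  obtain ⟨d', hd', hdist⟩ : ∃ d' ∈ N, dist d d' < r := by simpa using hs hd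
  have hle := l1Excess_le_add a v d' d
  have hmul : dist d' d * ∑ i, ‖a i‖ ≤ r * ∑ i, ‖a i‖ := by
    rw [dist_comm]
    gcongr
  linarith [hN d' hd']

theorem measurable_l1Excess [MeasurableSpace E] [BorelSpace E] (d : E) :
    Measurable fun p : (ι → E) × (ι → ℝ) => l1Excess p.1 p.2 d := by
  have hinner : Measurable fun b : E => ⟪b, d⟫_ℝ := by fun_prop
  refine Finset.measurable_sum _ fun i _ => ?_
  have := hinner.comp ((measurable_pi_apply i).comp
    (measurable_fst : Measurable fun p : (ι → E) × (ι → ℝ) => p.1))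
  simp only [Function.comp_def] at this
  fun_prop

end L1Excess

section Estimate

open scoped InnerProductSpace

variable {m n : ℕ}

/-- The `i`-th row of a matrix as a vector of Euclidean space, the regressor of the `i`-th
observation. -/
def euclideanRow (H : Matrix (Fin n) (Fin m) ℝ) (i : Fin n) : EuclideanSpace ℝ (Fin m) :=
  WithLp.toLp 2 (H i)

theorem inner_euclideanRow (H : Matrix (Fin n) (Fin m) ℝ) (i : Fin n)
    (d : EuclideanSpace ℝ (Fin m)) : ⟪euclideanRow H i, d⟫_ℝ = H.mulVec d.ofLp i := by
  simp [euclideanRow, PiLp.inner_apply, Matrix.mulVec, dotProduct, mul_comm]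

theorem exists_isL1Estimate (H : Matrix (Fin n) (Fin m) ℝ) (y : Fin n → ℝ) :
    ∃ xhat, IsL1Estimate H y xhat := by
  let A : EuclideanSpace ℝ (Fin m) →ₗ[ℝ] PiLp 1 (fun _ : Fin n => ℝ) :=
    (WithLp.linearEquiv 1 ℝ (Fin n → ℝ)).symm.toLinearMap ∘ₗ H.mulVecLin ∘ₗ
      (WithLp.linearEquiv 2 ℝ (Fin m → ℝ)).toLinearMap
  have hdist : ∀ z, dist (WithLp.toLp 1 y) (A z) = ∑ i, |y i - H.mulVec z.ofLp i| := fun z => by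
    rw [PiLp.dist_eq_sum (by simp)]
    simp [A, Real.dist_eq]
  have : ProperSpace (PiLp 1 (fun _ : Fin n => ℝ)) := FiniteDimensional.proper ℝ _
  obtain ⟨_, ⟨xhat, rfl⟩, hmin⟩ := (Submodule.closed_of_finiteDimensional
    (LinearMap.range A)).exists_infDist_eq_dist ⟨0, Submodule.zero_mem _⟩ (WithLp.toLp 1 y)
  refine ⟨xhat, fun z => ?_⟩
  rw [← hdist, ← hdist, ← hmin]
  exact Metric.infDist_le_dist_of_mem ⟨z, rfl⟩

theorem observation_sub_mulVec (H : Matrix (Fin n) (Fin m) ℝ) (x z : EuclideanSpace ℝ (Fin m))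
    (e w : Fin n → ℝ) (i : Fin n) :
    observation H x e w i - H.mulVec z.ofLp i = (e + w) i - ⟪euclideanRow H i, z - x⟫_ℝ := by
  rw [inner_sub_right, inner_euclideanRow, inner_euclideanRow]
  simp only [observation, Pi.add_apply]
  ring

theorem IsL1Estimate.l1Excess_sub_nonpos {H : Matrix (Fin n) (Fin m) ℝ}
    {x xhat : EuclideanSpace ℝ (Fin m)} {e w : Fin n → ℝ}
    (hx : IsL1Estimate H (observation H x e w) xhat) :
    l1Excess (euclideanRow H) (e + w) (xhat - x) ≤ 0 := by
  have hmin := hx x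
  simp only [observation_sub_mulVec, sub_self, inner_zero_right, sub_zero] at hmin
  rw [l1Excess, Finset.sum_sub_distrib]
  linarith

theorem IsL1Estimate.norm_sub_lt {H : Matrix (Fin n) (Fin m) ℝ}
    {x xhat : EuclideanSpace ℝ (Fin m)} {e w : Fin n → ℝ}
    (hx : IsL1Estimate H (observation H x e w) xhat) {ε : ℝ} (hε : 0 < ε)
    (hpos : ∀ d ∈ Metric.sphere 0 ε, 0 < l1Excess (euclideanRow H) (e + w) d) :
    ‖xhat - x‖ < ε := by
  by_contra! hle
  have hd : 0 < ‖xhat - x‖ := hε.trans_le hle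
  have hmem : (ε / ‖xhat - x‖) • (xhat - x) ∈ Metric.sphere 0 ε := by
    rw [mem_sphere_zero_iff_norm, norm_smul, norm_div, norm_norm, Real.norm_of_nonneg hε.le,
      div_mul_cancel₀ _ hd.ne']
  refine (hpos _ hmem).not_ge ?_
  calc _ ≤ ε / ‖xhat - x‖ * l1Excess (euclideanRow H) (e + w) (xhat - x) :=
        l1Excess_smul_le _ _ _ (by positivity) ((div_le_one hd).2 hle)
    _ ≤ 0 := mul_nonpos_of_nonneg_of_nonpos (by positivity) hx.l1Excess_sub_nonpos

end Estimate

theorem measurable_numSmall {n : ℕ} (t : ℝ) :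
    Measurable fun v : Fin n → ℝ => (numSmall t v : ℝ) := by
  have hsum : (fun v : Fin n → ℝ => (numSmall t v : ℝ))
      = fun v => ∑ i, if |v i| ≤ t then (1 : ℝ) else 0 := by
    funext v
    rw [numSmall, Set.ncard_eq_toFinset_card', ← Finset.sum_filter]
    simp
  rw [hsum]
  exact Finset.measurable_sum _ fun i _ => Measurable.ite
    (measurableSet_le (measurable_pi_apply i).abs measurable_const) measurable_const
    measurable_const

section HighProbability

variable {Ω : ℕ → Type*} [∀ n, MeasurableSpace (Ω n)] {P : ∀ n, Measure (Ω n)}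
  {E F : ∀ n, Set (Ω n)}

theorem WithHighProbability.mono (hE : WithHighProbability P E) (hEF : ∀ n, E n ⊆ F n) :
    WithHighProbability P F :=
  tendsto_of_tendsto_of_tendsto_of_le_of_le tendsto_const_nhds hE (fun _ => zero_le)
    fun n => measure_mono (Set.compl_subset_compl.2 (hEF n))

theorem WithHighProbability.inter (hE : WithHighProbability P E)
    (hF : WithHighProbability P F) : WithHighProbability P fun n => E n ∩ F n := by
  refine tendsto_of_tendsto_of_tendsto_of_le_of_le tendsto_const_nhds
    (by simpa only [add_zero] using Tendsto.add hE hF) (fun _ => zero_le) fun n => ?_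
  rw [Set.compl_inter]
  exact measure_union_le _ _

theorem WithHighProbability.biInter_finset {ι : Type*} (s : Finset ι) {G : ι → ∀ n, Set (Ω n)}
    (hG : ∀ i ∈ s, WithHighProbability P (G i)) :
    WithHighProbability P fun n => ⋂ i ∈ s, G i n := by
  refine tendsto_of_tendsto_of_tendsto_of_le_of_le tendsto_const_nhds
    (by simpa only [Finset.sum_const_zero] using tendsto_finsetSum s hG)
    (fun _ => zero_le) fun n => ?_
  simp only [Set.compl_iInter]
  exact measure_biUnion_finset_le s _

theorem withHighProbability_of_eventually_le_div {C : ℝ}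
    (h : ∀ᶠ n in atTop, P n (E n)ᶜ ≤ ENNReal.ofReal (C / n)) : WithHighProbability P E := by
  have hC := ENNReal.tendsto_ofReal (tendsto_const_div_atTop_nhds_zero_nat C)
  rw [ENNReal.ofReal_zero] at hC
  exact tendsto_of_tendsto_of_tendsto_of_le_of_le' tendsto_const_nhds hC
    (Eventually.of_forall fun _ => zero_le) h

end HighProbability

section Probability

variable {Ω : Type*} [MeasurableSpace Ω] {P : Measure Ω}

theorem measure_prodMk_mem_le_of_indepFun [IsProbabilityMeasure P] {α β : Type*}
    [MeasurableSpace α] [MeasurableSpace β]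
    {Y : Ω → α} {V : Ω → β} (hYV : IndepFun Y V P) (hY : AEMeasurable Y P)
    (hV : AEMeasurable V P) {B : Set (α × β)} (hB : MeasurableSet B) {b : ENNReal}
    (hb : ∀ v, P {ω | (Y ω, v) ∈ B} ≤ b) : P {ω | (Y ω, V ω) ∈ B} ≤ b := by
  have := Measure.isProbabilityMeasure_map hY (μ := P)
  have := Measure.isProbabilityMeasure_map hV (μ := P)
  calc P {ω | (Y ω, V ω) ∈ B}
      = ((P.map Y).prod (P.map V)) B := by
        rw [← hYV.map_prod_eq_prod_map_map hY hV,
          Measure.map_apply_of_aemeasurable (hY.prodMk hV) hB]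
        rfl
    _ = ∫⁻ v, P {ω | (Y ω, v) ∈ B} ∂P.map V := by
        rw [Measure.prod_apply_symm hB]
        refine lintegral_congr fun v => ?_
        rw [Measure.map_apply_of_aemeasurable hY (measurable_prodMk_right hB)]
        rfl
    _ ≤ ∫⁻ _, b ∂P.map V := lintegral_mono hb
    _ = b := by simp

theorem covariance_le_of_variance_le [IsFiniteMeasure P] {X Y : Ω → ℝ} (hX : MemLp X 2 P)
    (hY : MemLp Y 2 P) {B : ℝ} (hXB : Var[X; P] ≤ B) (hYB : Var[Y; P] ≤ B) : cov[X, Y; P] ≤ B := by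
  have hsub := variance_nonneg (X - Y) P
  rw [variance_sub hX hY] at hsub
  linarith

theorem card_filter_val_lt_add_le {n : ℕ} (L : ℕ) (i : Fin n) :
    (Finset.univ.filter fun j : Fin n => (j : ℕ) < i + L ∧ (i : ℕ) < j + L).card ≤ 2 * L := by
  have hinj := Finset.card_le_card_of_injOn (fun j : Fin n => (j : ℕ))
    (s := Finset.univ.filter fun j : Fin n => (j : ℕ) < i + L ∧ (i : ℕ) < j + L)
    (t := Finset.Ico (i + 1 - L) (i + L))
    (fun j hj => by
      simp only [Finset.coe_filter, Finset.mem_univ, true_and, Set.mem_ofPred_eq] at hj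
      simp only [Finset.coe_Ico, Set.mem_Ico]
      omega)
    Fin.val_injective.injOn
  rw [Nat.card_Ico] at hinj
  omega

theorem variance_sum_le_of_indepFun_of_le [IsFiniteMeasure P] {n : ℕ} (L : ℕ)
    {Z : Fin n → Ω → ℝ} {B : ℝ} (hZ : ∀ i, MemLp (Z i) 2 P) (hB : ∀ i, Var[Z i; P] ≤ B)
    (hind : ∀ i j : Fin n, (i : ℕ) + L ≤ j → IndepFun (Z i) (Z j) P) :
    Var[fun ω => ∑ i, Z i ω; P] ≤ 2 * L * B * n := by
  have hrow : ∀ i, ∑ j, cov[Z i, Z j; P] ≤ 2 * L * B := fun i => by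
    have hB0 : 0 ≤ B := (variance_nonneg (Z i) P).trans (hB i)
    calc ∑ j, cov[Z i, Z j; P]
        ≤ ∑ j : Fin n, if (j : ℕ) < i + L ∧ (i : ℕ) < j + L then B else 0 := by
          refine Finset.sum_le_sum fun j _ => ?_
          split_ifs with hnear
          · exact covariance_le_of_variance_le (hZ i) (hZ j) (hB i) (hB j)
          · rw [not_and_or, not_lt, not_lt] at hnear
            rcases hnear with hij | hji
            · exact ((hind i j hij).covariance_eq_zero (hZ i) (hZ j)).le
            · exact ((hind j i hji).symm.covariance_eq_zero (hZ i) (hZ j)).le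
      _ ≤ 2 * L * B := by
          rw [← Finset.sum_filter, Finset.sum_const, nsmul_eq_mul]
          exact mul_le_mul_of_nonneg_right (by exact_mod_cast card_filter_val_lt_add_le L i) hB0
  rw [variance_fun_sum hZ]
  calc ∑ i, ∑ j, cov[Z i, Z j; P] ≤ ∑ _i : Fin n, 2 * L * B :=
        Finset.sum_le_sum fun i _ => hrow i
    _ = 2 * L * B * n := by simp [mul_comm]

variable {g : Ω → ℝ}

theorem memLp_abs_sub_sub_abs [IsFiniteMeasure P] {p : ENNReal} (hg : MemLp g p P) (b : ℝ) :
    MemLp (fun ω => |b - g ω| - |b|) p P :=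
  ((memLp_const b).sub hg).abs.sub (memLp_const |b|)

variable [IsProbabilityMeasure P]

theorem variance_abs_sub_sub_abs_le (hg : MemLp g 2 P) (b : ℝ) :
    Var[fun ω => |b - g ω| - |b|; P] ≤ ∫ ω, g ω ^ 2 ∂P := by
  have hZ := memLp_abs_sub_sub_abs hg b
  refine (variance_le_expectation_sq hZ.1).trans
    (integral_mono hZ.integrable_sq hg.integrable_sq fun ω => sq_le_sq.2 ?_)
  simpa using abs_abs_sub_abs_le (b - g ω) b

theorem integral_abs_sub_sub_abs_nonneg (hg : Integrable g P) (hg0 : ∫ ω, g ω ∂P = 0) (b : ℝ) :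
    0 ≤ ∫ ω, (|b - g ω| - |b|) ∂P := by
  have hsub : Integrable (fun ω => b - g ω) P := (integrable_const b).sub hg
  have hjensen : |b| ≤ ∫ ω, |b - g ω| ∂P := by
    have := abs_integral_le_integral_abs (f := fun ω => b - g ω) (μ := P)
    rwa [integral_sub (integrable_const b) hg, hg0, integral_const, probReal_univ, one_smul,
      sub_zero] at this
  rw [integral_sub hsub.abs (integrable_const _)]
  simpa using hjensen

theorem le_integral_abs_sub_sub_abs (hg : Integrable g P) {b t : ℝ} (hb : |b| ≤ t) :
    ∫ ω, |g ω| ∂P - 2 * t ≤ ∫ ω, (|b - g ω| - |b|) ∂P := by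
  have hconst : ∫ ω, (|g ω| - 2 * t) ∂P = ∫ ω, |g ω| ∂P - 2 * t := by
    rw [integral_sub hg.abs (integrable_const _)]
    simp
  rw [← hconst]
  refine integral_mono (hg.abs.sub (integrable_const _))
    (memLp_one_iff_integrable.1 (memLp_abs_sub_sub_abs (memLp_one_iff_integrable.2 hg) b))
    fun ω => ?_
  have htri := abs_sub_abs_le_abs_sub (g ω) b
  rw [abs_sub_comm] at htri
  linarith

end Probability

section RandomDesign

open scoped InnerProductSpace

variable {E : Type*} [MeasurableSpace E]

/-- Random regressors `A 0, …, A (n - 1)` with common law `μ` such that regressors whose indices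
differ by at least `L` are independent; for the rows of an `n × m` Toeplitz matrix, `L = m`. -/
structure IsRandomDesign {Ω : Type*} [MeasurableSpace Ω] {n : ℕ} (P : Measure Ω) (μ : Measure E)
    (L : ℕ) (A : Fin n → Ω → E) : Prop where
  hasLaw : ∀ i, HasLaw (A i) μ P
  indepFun : ∀ i j : Fin n, (i : ℕ) + L ≤ j → IndepFun (A i) (A j) P

variable {Ω : Type*} [MeasurableSpace Ω] {P : Measure Ω} [IsProbabilityMeasure P] {μ : Measure E}
  {L n : ℕ} {A : Fin n → Ω → E}

theorem IsRandomDesign.measure_abs_sum_sub_ge_le (hA : IsRandomDesign P μ L A)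
    {f : Fin n → E → ℝ} (hf : ∀ i, Measurable (f i))
    (hf2 : ∀ i, MemLp (f i) 2 μ) {B : ℝ} (hB : ∀ i, Var[f i; μ] ≤ B) (hn : 0 < n) {c : ℝ}
    (hc : 0 < c) :
    P {ω | c * n ≤ |∑ i, f i (A i ω) - ∑ i, ∫ a, f i a ∂μ|}
      ≤ ENNReal.ofReal (2 * L * B / c ^ 2 / n) := by
  have hZ : ∀ i, MemLp (fun ω => f i (A i ω)) 2 P := fun i =>
    MemLp.comp_of_map (by rw [(hA.hasLaw i).map_eq]; exact hf2 i) (hA.hasLaw i).aemeasurable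
  have hmean : ∫ ω, ∑ i, f i (A i ω) ∂P = ∑ i, ∫ a, f i a ∂μ := by
    rw [integral_finsetSum _ fun i _ => (hZ i).integrable one_le_two]
    exact Finset.sum_congr rfl fun i _ =>
      (hA.hasLaw i).integral_comp (hf i).aestronglyMeasurable
  have hvarZ : ∀ i, Var[fun ω => f i (A i ω); P] ≤ B := fun i => by
    refine le_of_eq_of_le ?_ (hB i)
    rw [← (hA.hasLaw i).map_eq, variance_map (hf i).aemeasurable (hA.hasLaw i).aemeasurable]
    rfl
  have hvar := variance_sum_le_of_indepFun_of_le L hZ hvarZ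
    fun i j hij => (hA.indepFun i j hij).comp (hf i) (hf j)
  have : (0 : ℝ) < n := by exact_mod_cast hn
  rw [← hmean]
  refine (meas_ge_le_variance_div_sq (memLp_finsetSum Finset.univ fun i _ => hZ i)
    (by positivity : 0 < c * n)).trans (ENNReal.ofReal_le_ofReal ?_)
  calc _ ≤ 2 * L * B * n / (c * n) ^ 2 := by gcongr
    _ = 2 * L * B / c ^ 2 / n := by field_simp

theorem IsRandomDesign.measure_compl_sum_norm_le [NormedAddCommGroup E] [OpensMeasurableSpace E]
    (hA : IsRandomDesign P μ L A) (hμ : MemLp id 2 μ) (hn : 0 < n) :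
    P {ω | ∑ i, ‖A i ω‖ ≤ (∫ a, ‖a‖ ∂μ + 1) * n}ᶜ
      ≤ ENNReal.ofReal (2 * L * Var[fun a => ‖a‖; μ] / n) := by
  have hdev := hA.measure_abs_sum_sub_ge_le (f := fun _ a => ‖a‖) (fun _ => measurable_norm)
    (fun _ => hμ.norm) (fun _ => le_rfl) hn one_pos
  rw [one_pow, div_one] at hdev
  refine (measure_mono fun ω hω => ?_).trans hdev
  simp only [Set.mem_compl_iff, Set.mem_ofPred_eq, not_le, Finset.sum_const, Finset.card_univ,
    Fintype.card_fin, nsmul_eq_mul] at hω ⊢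
  refine le_trans ?_ (le_abs_self _)
  linarith

variable [NormedAddCommGroup E] [InnerProductSpace ℝ E]

theorem lipschitzWith_integral_abs_inner (hμ : Integrable id μ) :
    LipschitzWith (∫ a, ‖a‖ ∂μ).toNNReal fun d => ∫ a, |⟪a, d⟫_ℝ| ∂μ := by
  have hint : ∀ d, Integrable (fun a => |⟪a, d⟫_ℝ|) μ := fun d => (hμ.inner_const d).abs
  refine LipschitzWith.of_le_add_mul' _ fun d d' => ?_
  have hbound : Integrable (fun a => ‖a‖ * dist d d') μ := hμ.norm.mul_const _
  rw [← integral_mul_const, ← integral_add (hint d') hbound]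
  refine integral_mono (hint d) ((hint d').add hbound) fun a => ?_
  have htri := abs_sub_abs_le_abs_sub ⟪a, d⟫_ℝ ⟪a, d'⟫_ℝ
  rw [← inner_sub_right] at htri
  have hcs := abs_real_inner_le_norm a (d - d')
  rw [← dist_eq_norm] at hcs
  linarith

theorem exists_pos_le_integral_abs_inner (hμ : Integrable id μ) {s : Set E} (hs : IsCompact s)
    (hs0 : ∀ d ∈ s, ¬ (fun a => ⟪a, d⟫_ℝ) =ᵐ[μ] 0) :
    ∃ κ > 0, ∀ d ∈ s, κ ≤ ∫ a, |⟪a, d⟫_ℝ| ∂μ := by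
  refine hs.exists_forall_le' (lipschitzWith_integral_abs_inner hμ).continuous.continuousOn
    fun d hd => (integral_nonneg fun a => abs_nonneg _).lt_of_ne' fun hzero => hs0 d hd ?_
  filter_upwards [(integral_eq_zero_iff_of_nonneg (fun a => abs_nonneg _)
    (hμ.inner_const d).abs).1 hzero] with a ha using abs_eq_zero.1 ha

variable [IsProbabilityMeasure μ]

theorem numSmall_mul_le_sum_integral {d : E} (hint : Integrable (fun a => ⟪a, d⟫_ℝ) μ)
    (hmean : ∫ a, ⟪a, d⟫_ℝ ∂μ = 0) {n : ℕ} (v : Fin n → ℝ) (t : ℝ) :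
    numSmall t v * (∫ a, |⟪a, d⟫_ℝ| ∂μ - 2 * t)
      ≤ ∑ i, ∫ a, (|v i - ⟪a, d⟫_ℝ| - |v i|) ∂μ := by
  rw [numSmall, Set.ncard_eq_toFinset_card', ← nsmul_eq_mul, ← Finset.sum_const]
  calc _ = ∑ i, if |v i| ≤ t then ∫ a, |⟪a, d⟫_ℝ| ∂μ - 2 * t else 0 := by
        rw [← Finset.sum_filter]
        simp
    _ ≤ _ := Finset.sum_le_sum fun i _ => by
        split_ifs with hvi
        · exact le_integral_abs_sub_sub_abs hint hvi
        · exact integral_abs_sub_sub_abs_nonneg hint hmean (v i)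

variable [BorelSpace E]

theorem IsRandomDesign.measure_l1Excess_le (hA : IsRandomDesign P μ L A) (hμ : MemLp id 2 μ)
    {d : E} (hmean : ∫ a, ⟪a, d⟫_ℝ ∂μ = 0) (hn : 0 < n) {t c : ℝ} (ht : 0 < t)
    (htd : 4 * t ≤ ∫ a, |⟪a, d⟫_ℝ| ∂μ) (hc : 0 < c) {v : Fin n → ℝ}
    (hv : c * n ≤ numSmall t v) :
    P {ω | l1Excess (fun i => A i ω) v d ≤ c * t * n}
      ≤ ENNReal.ofReal (2 * L * (∫ a, ⟪a, d⟫_ℝ ^ 2 ∂μ) / (c * t) ^ 2 / n) := by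
  have hinner : MemLp (fun a => ⟪a, d⟫_ℝ) 2 μ := hμ.inner_const d
  have hmeanExcess : c * n * (2 * t) ≤ ∑ i, ∫ a, (|v i - ⟪a, d⟫_ℝ| - |v i|) ∂μ := by
    refine le_trans ?_ (numSmall_mul_le_sum_integral (hinner.integrable one_le_two) hmean v t)
    gcongr
    linarith
  refine (measure_mono fun ω hω => ?_).trans
    (hA.measure_abs_sum_sub_ge_le (f := fun i a => |v i - ⟪a, d⟫_ℝ| - |v i|)
      (fun i => by fun_prop) (fun i => memLp_abs_sub_sub_abs hinner (v i))
      (fun i => variance_abs_sub_sub_abs_le hinner (v i)) hn (mul_pos hc ht))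
  have hle : l1Excess (fun i => A i ω) v d ≤ c * t * n := hω
  rw [l1Excess] at hle
  rw [Set.mem_ofPred_eq, abs_sub_comm]
  refine le_trans ?_ (le_abs_self _)
  linarith

theorem IsRandomDesign.measure_compl_lt_l1Excess_le (hA : IsRandomDesign P μ L A)
    (hμ : MemLp id 2 μ) {d : E} (hmean : ∫ a, ⟪a, d⟫_ℝ ∂μ = 0) (hn : 0 < n) {t c : ℝ}
    (ht : 0 < t) (htd : 4 * t ≤ ∫ a, |⟪a, d⟫_ℝ| ∂μ) (hc : 0 < c) {V : Ω → Fin n → ℝ}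
    (hV : AEMeasurable V P) (hAV : IndepFun (fun ω i => A i ω) V P) :
    P {ω | c * n ≤ numSmall t (V ω) → c * t * n < l1Excess (fun i => A i ω) (V ω) d}ᶜ
      ≤ ENNReal.ofReal (2 * L * (∫ a, ⟪a, d⟫_ℝ ^ 2 ∂μ) / (c * t) ^ 2 / n) := by
  let B : Set ((Fin n → E) × (Fin n → ℝ)) :=
    {p | c * n ≤ numSmall t p.2} ∩ {p | l1Excess p.1 p.2 d ≤ c * t * n}
  have hB : MeasurableSet B :=
    (measurableSet_le measurable_const ((measurable_numSmall t).comp measurable_snd)).inter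
      (measurableSet_le (measurable_l1Excess d) measurable_const)
  have hcompl : {ω | c * n ≤ numSmall t (V ω) →
      c * t * n < l1Excess (fun i => A i ω) (V ω) d}ᶜ = {ω | ((fun i => A i ω), V ω) ∈ B} := by
    ext ω
    simp [B]
  rw [hcompl]
  refine measure_prodMk_mem_le_of_indepFun hAV
    (aemeasurable_pi_lambda _ fun i => (hA.hasLaw i).aemeasurable) hV hB fun v => ?_
  by_cases hv : c * n ≤ numSmall t v
  · exact (measure_mono fun ω hω => hω.2).trans
      (hA.measure_l1Excess_le hμ hmean hn ht htd hc hv)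
  · simp [B, hv]

end RandomDesign

open scoped InnerProductSpace in
theorem withHighProbability_l1Excess_pos {E : Type*} [NormedAddCommGroup E]
    [InnerProductSpace ℝ E] [MeasurableSpace E] [BorelSpace E] {μ : Measure E}
    [IsProbabilityMeasure μ] (hμ : MemLp id 2 μ) {s : Set E} (hs : IsCompact s)
    (hmean : ∀ d ∈ s, ∫ a, ⟪a, d⟫_ℝ ∂μ = 0) (hs0 : ∀ d ∈ s, ¬ (fun a => ⟪a, d⟫_ℝ) =ᵐ[μ] 0)
    {Ω : ℕ → Type*} [∀ n, MeasurableSpace (Ω n)] {P : ∀ n, Measure (Ω n)}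
    [∀ n, IsProbabilityMeasure (P n)] {L : ℕ} {A : ∀ n, Fin n → Ω n → E}
    {V : ∀ n, Ω n → Fin n → ℝ} (hA : ∀ᶠ n in atTop, IsRandomDesign (P n) μ L (A n))
    (hV : ∀ᶠ n in atTop, AEMeasurable (V n) (P n))
    (hAV : ∀ᶠ n in atTop, IndepFun (fun ω i => A n i ω) (V n) (P n))
    (hsmall : ∀ t > 0, ∃ c > (0 : ℝ),
      WithHighProbability P fun n => {ω | c * n ≤ numSmall t (V n ω)}) :
    WithHighProbability P fun n => {ω | ∀ d ∈ s, 0 < l1Excess (fun i => A n i ω) (V n ω) d} := by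
  obtain ⟨κ, hκ, hκs⟩ := exists_pos_le_integral_abs_inner (hμ.integrable one_le_two) hs hs0
  obtain ⟨t, ht, htκ⟩ : ∃ t > 0, 4 * t = κ := ⟨κ / 4, by positivity, by ring⟩
  obtain ⟨c, hc, hcount⟩ := hsmall t ht
  set K := ∫ a, ‖a‖ ∂μ + 1
  have hK0 : 0 < K := add_pos_of_nonneg_of_pos (integral_nonneg fun a => norm_nonneg a) one_pos
  obtain ⟨N, hNs, hNfin, hcover⟩ := hs.finite_cover_balls (div_pos (mul_pos hc ht) hK0)
  have hnet : WithHighProbability P fun n => ⋂ d ∈ hNfin.toFinset, {ω |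
      c * n ≤ numSmall t (V n ω) → c * t * n < l1Excess (fun i => A n i ω) (V n ω) d} := by
    refine .biInter_finset _ fun d hd => withHighProbability_of_eventually_le_div
      (C := 2 * L * (∫ a, ⟪a, d⟫_ℝ ^ 2 ∂μ) / (c * t) ^ 2) ?_
    have hds : d ∈ s := hNs (hNfin.mem_toFinset.1 hd)
    filter_upwards [hA, hV, hAV, eventually_gt_atTop 0] with n hAn hVn hAVn hn
    exact hAn.measure_compl_lt_l1Excess_le hμ (hmean d hds) hn ht (htκ.trans_le (hκs d hds)) hc
      hVn hAVn
  have hnorm : WithHighProbability P fun n => {ω | ∑ i, ‖A n i ω‖ ≤ K * n} := by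
    refine withHighProbability_of_eventually_le_div (C := 2 * L * Var[fun a => ‖a‖; μ]) ?_
    filter_upwards [hA, eventually_gt_atTop 0] with n hAn hn
    exact hAn.measure_compl_sum_norm_le hμ hn
  refine ((hnet.inter hnorm).inter hcount).mono ?_
  rintro n ω ⟨⟨hωnet, hωnorm⟩, hωcount⟩ d hd
  simp only [Set.mem_iInter, Set.Finite.mem_toFinset] at hωnet
  refine l1Excess_pos_of_subset_iUnion_ball hcover (fun d' hd' => hωnet d' hd' hωcount) ?_ hd
  calc c * t / K * ∑ i, ‖A n i ω‖ ≤ c * t / K * (K * n) := by gcongr; exact hωnorm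
    _ = c * t * n := by field_simp

section IidLaw

open scoped InnerProductSpace

variable {ι : Type*} [Fintype ι] {ν : Measure ℝ}

/-- The law on Euclidean space of a vector whose entries are independent with law `ν`. -/
noncomputable def iidLaw (ι : Type*) [Fintype ι] (ν : Measure ℝ) :
    Measure (EuclideanSpace ℝ ι) :=
  (Measure.pi fun _ : ι => ν).map (WithLp.toLp 2)

theorem hasLaw_toLp_iidLaw {Ω : Type*} [MeasurableSpace Ω] {P : Measure Ω} {X : ι → Ω → ℝ}
    (hlaw : ∀ i, HasLaw (X i) ν P) (hX : iIndepFun X P) :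
    HasLaw (fun ω => WithLp.toLp 2 fun i => X i ω) (iidLaw ι ν) P :=
  HasLaw.fun_comp ⟨by fun_prop, rfl⟩ (hX.hasLaw_pi hlaw)

variable [IsProbabilityMeasure ν]

instance : IsProbabilityMeasure (iidLaw ι ν) :=
  Measure.isProbabilityMeasure_map (by fun_prop)

theorem memLp_id_iidLaw {p : ENNReal} (hν : MemLp id p ν) : MemLp id p (iidLaw ι ν) := by
  refine (memLp_map_measure_iff aestronglyMeasurable_id (by fun_prop)).2 (MemLp.of_eval_piLp ?_)
  exact fun i => hν.comp_measurePreserving (measurePreserving_eval _ i)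

theorem integral_inner_iidLaw (hν : Integrable id ν) (hν0 : ∫ z, z ∂ν = 0)
    (d : EuclideanSpace ℝ ι) : ∫ a, ⟪a, d⟫_ℝ ∂iidLaw ι ν = 0 := by
  rw [iidLaw, integral_map (by fun_prop) (by fun_prop)]
  simp only [PiLp.inner_apply, RCLike.inner_apply, conj_trivial]
  have hint : ∀ i, Integrable (fun a : ι → ℝ => a i) (Measure.pi fun _ => ν) := fun i =>
    integrable_comp_eval (μ := fun _ : ι => ν) hν
  rw [integral_finsetSum _ fun i _ => (hint i).const_mul (d i)]
  refine Finset.sum_eq_zero fun i _ => ?_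
  rw [integral_const_mul, integral_comp_eval (μ := fun _ : ι => ν) (i := i) (f := fun z => z)
    (by fun_prop), hν0, mul_zero]

theorem variance_inner_iidLaw (hν : MemLp id 2 ν) (d : EuclideanSpace ℝ ι) :
    Var[fun a => ⟪a, d⟫_ℝ; iidLaw ι ν] = ‖d‖ ^ 2 * Var[id; ν] := by
  rw [iidLaw, variance_map (by fun_prop) (by fun_prop)]
  calc Var[fun a => ⟪WithLp.toLp 2 a, d⟫_ℝ; Measure.pi fun _ : ι => ν]
      = Var[∑ i, fun a : ι → ℝ => d i * a i; Measure.pi fun _ : ι => ν] := by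
        congr with a
        simp [PiLp.inner_apply]
    _ = ∑ i, d i ^ 2 * Var[id; ν] := by
        rw [variance_sum_pi (X := fun i z => d i * z) fun i => hν.const_mul (d i)]
        exact Finset.sum_congr rfl fun i _ => variance_const_mul (d i) id ν
    _ = ‖d‖ ^ 2 * Var[id; ν] := by
        rw [← Finset.sum_mul, EuclideanSpace.real_norm_sq_eq]

theorem not_inner_ae_eq_zero_iidLaw (hν : MemLp id 2 ν) (hvar : Var[id; ν] ≠ 0)
    {d : EuclideanSpace ℝ ι} (hd : d ≠ 0) : ¬ (fun a => ⟪a, d⟫_ℝ) =ᵐ[iidLaw ι ν] 0 := by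
  intro hzero
  have hvar0 := variance_inner_iidLaw hν d
  rw [variance_congr hzero, variance_zero] at hvar0
  simp [hd, hvar] at hvar0

end IidLaw

section Toeplitz

variable {m n : ℕ}

/-- The index of the input that is the `(i, j)` entry of the Toeplitz matrix. -/
def toeplitzIndex (i : Fin n) (j : Fin m) : Set.Icc (2 - (m : ℤ)) (n : ℤ) :=
  ⟨2 - (m : ℤ) + (i : ℕ) + (j : ℕ), by have := i.2; have := j.2; constructor <;> omega⟩

theorem toeplitzIndex_injective (i : Fin n) :
    Function.Injective (toeplitzIndex i : Fin m → Set.Icc (2 - (m : ℤ)) (n : ℤ)) := by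
  intro j j' hjj'
  simp only [toeplitzIndex, Subtype.ext_iff] at hjj'
  exact Fin.ext (by omega)

theorem toeplitzIndex_ne_of_add_le {i i' : Fin n} (hii' : (i : ℕ) + m ≤ i') (j j' : Fin m) :
    toeplitzIndex i j ≠ toeplitzIndex i' j' := by
  simp only [toeplitzIndex, ne_eq, Subtype.ext_iff]
  have := j.2
  omega

variable {Ω : Type*} [MeasurableSpace Ω] {P : Measure Ω} {ν : Measure ℝ} {h : ℤ → Ω → ℝ}

theorem indepFun_toeplitz_row
    (hh : ∀ i : Set.Icc (2 - (m : ℤ)) (n : ℤ), AEMeasurable (h i) P)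
    (hiid : iIndepFun (fun i : Set.Icc (2 - (m : ℤ)) (n : ℤ) => h i) P)
    {i i' : Fin n} (hii' : (i : ℕ) + m ≤ i') :
    IndepFun (fun ω => toeplitzMatrix m n (fun k => h k ω) i)
      (fun ω => toeplitzMatrix m n (fun k => h k ω) i') P := by
  classical
  let S (i : Fin n) : Finset (Set.Icc (2 - (m : ℤ)) (n : ℤ)) := Finset.univ.image (toeplitzIndex i)
  have hS : ∀ i j, toeplitzIndex i j ∈ S i := fun i j =>
    Finset.mem_image_of_mem _ (Finset.mem_univ j)
  have hdisj : Disjoint (S i) (S i') := by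
    simp only [S, Finset.disjoint_left, Finset.mem_image, Finset.mem_univ, true_and, not_exists,
      forall_exists_index]
    rintro _ j rfl j' hj'
    exact toeplitzIndex_ne_of_add_le hii' j j' hj'.symm
  exact (hiid.indepFun_finset₀ (S i) (S i') hdisj hh).comp
    (φ := fun a j => a ⟨toeplitzIndex i j, hS i j⟩)
    (ψ := fun a j => a ⟨toeplitzIndex i' j, hS i' j⟩) (by fun_prop) (by fun_prop)

theorem isRandomDesign_toeplitz
    (hlaw : ∀ i ∈ Set.Icc (2 - (m : ℤ)) (n : ℤ), HasLaw (h i) ν P)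
    (hiid : iIndepFun (fun i : Set.Icc (2 - (m : ℤ)) (n : ℤ) => h i) P) :
    IsRandomDesign P (iidLaw (Fin m) ν) m
      fun (i : Fin n) ω => euclideanRow (toeplitzMatrix m n fun k => h k ω) i where
  hasLaw i := hasLaw_toLp_iidLaw (fun j => hlaw _ (toeplitzIndex i j).2)
    (hiid.precomp (toeplitzIndex_injective i))
  indepFun _ _ hii' := (indepFun_toeplitz_row (fun k => (hlaw k k.2).aemeasurable) hiid hii').comp
    (φ := WithLp.toLp 2) (ψ := WithLp.toLp 2) (by fun_prop) (by fun_prop)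

theorem indepFun_toeplitz_of_indepFun_input {β : Type*} [MeasurableSpace β] {V : Ω → β}
    (hhV : IndepFun (fun ω (i : Set.Icc (2 - (m : ℤ)) (n : ℤ)) => h i ω) V P) :
    IndepFun (fun ω (i : Fin n) => euclideanRow (toeplitzMatrix m n fun k => h k ω) i) V P :=
  hhV.comp
    (φ := fun (a : Set.Icc (2 - (m : ℤ)) (n : ℤ) → ℝ) (i : Fin n) =>
      WithLp.toLp 2 fun j : Fin m => a (toeplitzIndex i j))
    (ψ := id) (by fun_prop) measurable_id

end Toeplitz

theorem theorem4_general (m : ℕ) {Ω : ℕ → Type*} [∀ n, MeasurableSpace (Ω n)]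
    (P : ∀ n, Measure (Ω n)) [∀ n, IsProbabilityMeasure (P n)]
    (ν : Measure ℝ) [IsProbabilityMeasure ν] (hν : MemLp id 2 ν) (hν0 : ∫ z, z ∂ν = 0)
    (hvar : Var[id; ν] ≠ 0)
    (h : ∀ n, ℤ → Ω n → ℝ) (x : ∀ n, Ω n → EuclideanSpace ℝ (Fin m))
    (e w : ∀ n, Ω n → Fin n → ℝ)
    (hlaw : ∀ n, m < n → ∀ i ∈ Set.Icc (2 - (m : ℤ)) (n : ℤ), HasLaw (h n i) ν (P n))
    (hiid : ∀ n, m < n →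
      iIndepFun (fun (i : Set.Icc (2 - (m : ℤ)) (n : ℤ)) => h n i) (P n))
    (hew : ∀ n, m < n → AEMeasurable (fun ω => e n ω + w n ω) (P n))
    (hindep : ∀ n, m < n →
      IndepFun (fun ω (i : Set.Icc (2 - (m : ℤ)) (n : ℤ)) => h n i ω)
        (fun ω => e n ω + w n ω) (P n))
    (hsmall : ∀ t > 0, ∃ c > (0 : ℝ),
      WithHighProbability P fun n => {ω | c * n ≤ numSmall t (e n ω + w n ω)}) :
    (∀ n (ω : Ω n), ∃ xhat, IsL1Estimate (toeplitzMatrix m n fun i => h n i ω)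
        (observation (toeplitzMatrix m n fun i => h n i ω) (x n ω) (e n ω) (w n ω)) xhat) ∧
    ∀ ε, 0 < ε →
      WithHighProbability P fun n => {ω | ∀ xhat,
        IsL1Estimate (toeplitzMatrix m n fun i => h n i ω)
          (observation (toeplitzMatrix m n fun i => h n i ω) (x n ω) (e n ω) (w n ω)) xhat →
        ‖xhat - x n ω‖ < ε} := by
  refine ⟨fun n ω => exists_isL1Estimate _ _, fun ε hε => ?_⟩
  have hn := eventually_gt_atTop m
  have hpos := withHighProbability_l1Excess_pos (memLp_id_iidLaw hν)
    (isCompact_sphere (0 : EuclideanSpace ℝ (Fin m)) ε)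
    (fun d _ => integral_inner_iidLaw (hν.integrable one_le_two) hν0 d)
    (fun d hd => not_inner_ae_eq_zero_iidLaw hν hvar (ne_zero_of_mem_sphere hε.ne' ⟨d, hd⟩))
    (hn.mono fun n hn => isRandomDesign_toeplitz (hlaw n hn) (hiid n hn))
    (hn.mono hew) (hn.mono fun n hn => indepFun_toeplitz_of_indepFun_input (hindep n hn)) hsmall
  exact hpos.mono fun n ω hω xhat hxhat => hxhat.norm_sub_lt hε hω

theorem theorem4 (m : ℕ) (hm : 0 < m)
    -- for each `n`, the probability space that carries the `n`-th problem
    {Ω : ℕ → Type*} [∀ n, MeasurableSpace (Ω n)]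
    (P : ∀ n, Measure (Ω n)) [∀ n, IsProbabilityMeasure (P n)]
    -- the input `h_i`, the unknown state `x`, the outliers `e` and the observation noise `w`
    (h : ∀ n, ℤ → Ω n → ℝ)
    (x : ∀ n, Ω n → EuclideanSpace ℝ (Fin m))
    (e w : ∀ n, Ω n → Fin n → ℝ)
    -- `h_i`, `-m+2 ≤ i ≤ n`, are i.i.d. standard Gaussian
    (hlaw : ∀ n, m < n → ∀ i ∈ Set.Icc (2 - (m : ℤ)) (n : ℤ),
      HasLaw (h n i) (gaussianReal 0 1) (P n))
    (hiid : ∀ n, m < n →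
      iIndepFun (fun (i : Set.Icc (2 - (m : ℤ)) (n : ℤ)) => h n i) (P n))
    -- the total disturbance `e + w` is independent of the input
    (he : ∀ n, m < n → AEMeasurable (e n) (P n))
    (hw : ∀ n, m < n → AEMeasurable (w n) (P n))
    (hindep : ∀ n, m < n →
      IndepFun (fun ω (i : Set.Icc (2 - (m : ℤ)) (n : ℤ)) => h n i ω)
        (fun ω => e n ω + w n ω) (P n))
    -- `e` has at most `β n` nonzero entries
    (β : ℝ) (hβ : β < 1)
    (hsparse : ∀ n, m < n → ∀ᵐ ω ∂(P n), (numNonzero (e n ω) : ℝ) ≤ β * n)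
    -- with high probability at least `α(t) n` entries of `e + w` have magnitude at most `t`
    (α : ℝ → ℝ) (hα : ∀ t, 0 < t → 0 < α t)
    (hsmall : ∀ t, 0 < t →
      WithHighProbability P fun n => {ω | α t * n ≤ (numSmall t (e n ω + w n ω) : ℝ)}) :
    (∀ n (ω : Ω n), ∃ xhat, IsL1Estimate (toeplitzMatrix m n fun i => h n i ω)
        (observation (toeplitzMatrix m n fun i => h n i ω) (x n ω) (e n ω) (w n ω)) xhat) ∧
    ∀ ε, 0 < ε →
      WithHighProbability P fun n => {ω | ∀ xhat,
        IsL1Estimate (toeplitzMatrix m n fun i => h n i ω)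
          (observation (toeplitzMatrix m n fun i => h n i ω) (x n ω) (e n ω) (w n ω)) xhat →
        ‖xhat - x n ω‖ < ε} := by
  exact theorem4_general m P (gaussianReal 0 1) (memLp_id_gaussianReal 2) integral_id_gaussianReal
    (by simp) h x e w hlaw hiid (fun n hn => (he n hn).add (hw n hn)) hindep
    fun t ht => ⟨α t, hα t ht, hsmall t ht⟩
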